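/- Let $\mathcal T$ be a finite rooted (non-planar) tree, drawn with its root at the bottom. Its graph $\mathbb G(\mathcal T)$ has as vertices the edges of $\mathcal T$, two distinct ones being adjacent when they share a node of $\mathcal T$. An edge of $\mathbb G(\mathcal T)$ is \emph{solid} if the upper end of one of the two tree edges is the lower end of the other, and \emph{dashed} otherwise (the two tree edges are then siblings). The level of a tree edge is the distance of its upper end from the root. A \emph{min-path} is a path of minimum length between two vertices. View $\mathbb G(\mathcal T)$ as a hypergraph $\mathbf H$ whose hyperedges are the singletons and the edges of the graph. The (nonempty) faces of its hypergraph polytope are the \emph{constructs} of $\mathbf H$: non-planar rooted trees obtained by choosing a nonempty set $Y\subseteq H$ of vertices as the root label and grafting onto it, recursively, one construct of each connected component of $\mathbf H_{H\setminus Y}$. They are ordered by the partial order generated by contracting an edge of the construct and merging (taking the union of) the labels of its two ends. The vertices of the polytope are the \emph{constructions} (all labels are singletons). The edges of the polytope are the constructs $E$ with all labels singletons except one, which is a two-element set $\{u,v\}$; the vertices of $E$ are the two constructions lying below $E$. A construction $V$ encodes a decomposition of $\mathcal T$, written as a fully parenthesised word in the nodes of $\mathcal T$: if the root of $V$ is labelled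 $x$, then removing the edge $x$ cuts $\mathcal T$ into the part containing the lower end of $x$ and the part containing its upper end, and the word is $(w_1w_2)$, where $w_1,w_2$ are the words of these two parts respectively; each part is either a single node (a letter), or it has an edge set which is a connected component of $\mathbb G(\mathcal T)\setminus\{x\}$ and is decomposed by the corresponding subtree of $V$. An edge $E$ of the polytope with vertices $V,V'$ is a \emph{$\beta$-arrow} (sequential associativity) $V\to V'$ if the word of $V'$ is obtained from that of $V$ by replacing a subword $(w_1w_2)w_3$ by $w_1(w_2w_3)$; it is a \emph{$\theta$-arrow} (parallel associativity) $V\to V'$ if the word of $V'$ is obtained from that of $V$ by replacing a subword $(w_1w_2)w_3$ by $(w_1w_3)w_2$. \textbf{Theorem.} Let $E$ be an edge of the hypergraph polytope of $\mathbb G(\mathcal T)$, with two-element node $\{u,v\}$. Then there is a unique min-path $p$ between $u$ and $v$ in $\mathbb G(\mathcal T)$, and: \begin{enumerate} \item $E$ is a $\beta$-arrow (in one of the two directions) if and only if $p$ consists only of solid edges; \item $E$ is a $\theta$-arrow if and only if $p$ does not consist only of solid edges; \item if $E$ is a $\beta$-arrow $V\to V'$, then the label $u$ appears below the label $v$ in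 $V'$ (i.e. the node labelled $v$ is a descendant of the node labelled $u$) if and only if the level of $u$ is smaller than the level of $v$. \end{enumerate} -/

import Mathlib

namespace Operadic

universe u

/-! ### Connectedness in hypergraphs

The polytopes below are built from Mathlib's `Hypergraph`. -/

section Hypergraph

variable {α : Type u}

/-- The set `H_X` of the hyperedges of `H` that are contained in `X`. -/
def edgesIn (H : Hypergraph α) (X : Set α) : Set (Set α) :=
  {Z | Z ∈ H.edgeSet ∧ Z ⊆ X}

/-- A nonempty set `X` of vertices is connected in `H` if there is no partition of `X` into two
nonempty parts `X₁`, `X₂` such that every hyperedge of `H` inside `X` lies inside `X₁` or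
inside `X₂`. -/
def IsConnected (H : Hypergraph α) (X : Set α) : Prop :=
  X ⊆ H.vertexSet ∧ X.Nonempty ∧
    ∀ X₁ X₂ : Set α, X₁ ∪ X₂ = X → Disjoint X₁ X₂ → X₁.Nonempty → X₂.Nonempty →
      edgesIn H X ≠ edgesIn H X₁ ∪ edgesIn H X₂

/-- `C` is a connected component of the hypergraph `H_X`: it is a connected subset of `X`, and
every hyperedge inside `X` lies inside `C` or inside `X \ C`. -/
def IsComponent (H : Hypergraph α) (X C : Set α) : Prop :=
  C ⊆ X ∧ IsConnected H C ∧ edgesIn H X = edgesIn H C ∪ edgesIn H (X \ C)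

/-- A graph, seen as an atomic hypergraph: the hyperedges are all singletons and all edges. -/
def ofGraph (G : SimpleGraph α) : Hypergraph α where
  vertexSet := Set.univ
  edgeSet := {e | (∃ v, e = {v}) ∨ ∃ v w, G.Adj v w ∧ e = {v, w}}
  subset_vertexSet_of_mem_edgeSet' := fun _ _ => Set.subset_univ _

/-! ### Constructs: the faces of the hypergraph polytope -/

/-- Constructs of the hypergraph `H_K` (`K` a set of vertices of `H`): choose a nonempty subset `Y`
of `K` as the label of the root, and graft on it one construct of `H_C` for each connected
component `C` of `H_{K \ Y}`. The subtrees of a node are indexed by the components, so their order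
plays no role, and the case `Y = K`, in which there are no components, is the one-node tree. The
constructs of `H` are those of `H_K` for `K` the full vertex set. -/
inductive Construct (H : Hypergraph α) : Set α → Type u
  | node {K : Set α} (Y : Set α) (hne : Y.Nonempty) (hsub : Y ⊆ K)
      (sub : ∀ C : Set α, IsComponent H (K \ Y) C → Construct H C) : Construct H K

namespace Construct

variable {H : Hypergraph α}

/-- The labels of the nodes of a construct (distinct nodes have disjoint labels). -/
def labels : {K : Set α} → Construct H K → Set (Set α)
  | _, node Y _ _ sub => insert Y {Z | ∃ C, ∃ hC, Z ∈ labels (sub C hC)}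

/-- `S.Below A B`: the label `A` occurs below the label `B` in the construct `S` (roots are at the
bottom), that is, the node labelled `B` is a proper descendant of the node labelled `A`. -/
def Below (A B : Set α) : {K : Set α} → Construct H K → Prop
  | _, node Y _ _ sub =>
      (Y = A ∧ ∃ C, ∃ hC, B ∈ labels (sub C hC)) ∨ ∃ C, ∃ hC, Below A B (sub C hC)

/-- The partial order on the constructs of `H_K`, generated by the contraction of an edge of the
tree (the labels of its two ends being merged), at the root or inside one of the subtrees. -/
inductive Le : {K : Set α} → Construct H K → Construct H K → Prop
  | refl {K : Set α} (S : Construct H K) : Le S S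
  | trans {K : Set α} {S T U : Construct H K} : Le S T → Le T U → Le S U
  /-- `Y(X(T₁₁,…,T₁ₘ),T₂,…,Tₙ) ≤ (Y ∪ X)(T₁₁,…,T₁ₘ,T₂,…,Tₙ)`, where `X(T₁₁,…,T₁ₘ)` is the
  subtree at the component `C₀` of `K \ Y`. -/
  | contract {K : Set α} {Y X C₀ : Set α} {hne : Y.Nonempty} {hsub : Y ⊆ K}
      {sub : ∀ C : Set α, IsComponent H (K \ Y) C → Construct H C}
      {hne₀ : X.Nonempty} {hsub₀ : X ⊆ C₀}
      {sub₀ : ∀ C : Set α, IsComponent H (C₀ \ X) C → Construct H C}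
      {hneU : (Y ∪ X).Nonempty} {hsubU : Y ∪ X ⊆ K}
      {subU : ∀ C : Set α, IsComponent H (K \ (Y ∪ X)) C → Construct H C}
      (h₀ : IsComponent H (K \ Y) C₀) (hX : sub C₀ h₀ = node X hne₀ hsub₀ sub₀)
      (hin : ∀ C hU h, subU C hU = sub₀ C h) (hout : ∀ C hU h, subU C hU = sub C h) :
      Le (node Y hne hsub sub) (node (Y ∪ X) hneU hsubU subU)
  /-- `Y(T₁,T₂,…,Tₙ) ≤ Y(T₁',T₂,…,Tₙ)` whenever `T₁ ≤ T₁'`. -/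
  | congr {K : Set α} {Y C₀ : Set α} {hne : Y.Nonempty} {hsub : Y ⊆ K}
      {sub sub' : ∀ C : Set α, IsComponent H (K \ Y) C → Construct H C}
      (h₀ : IsComponent H (K \ Y) C₀) (hle : Le (sub C₀ h₀) (sub' C₀ h₀))
      (hrest : ∀ C h, C ≠ C₀ → sub C h = sub' C h) :
      Le (node Y hne hsub sub) (node Y hne hsub sub')

/-- A construction is a construct all of whose nodes are labelled with singletons. These are the
vertices of the polytope. -/
def IsConstruction {K : Set α} (V : Construct H K) : Prop :=
  ∀ Y ∈ V.labels, ∃ x, Y = {x}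

/-- `E` is an edge of the polytope with two-element node `{x, y}`: all the other nodes of `E` are
labelled with singletons. -/
def IsEdge {K : Set α} (E : Construct H K) (x y : α) : Prop :=
  x ≠ y ∧ ({x, y} : Set α) ∈ E.labels ∧ ∀ Y ∈ E.labels, Y ≠ {x, y} → ∃ z, Y = {z}

/-- `V` and `V'` are the two vertices of the face `E`: they are distinct, and they are exactly
the vertices of the polytope that lie below `E`. -/
def HasEnds {K : Set α} (E V V' : Construct H K) : Prop :=
  V ≠ V' ∧ ∀ W : Construct H K, (W.IsConstruction ∧ Le W E) ↔ (W = V ∨ W = V')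

end Construct

end Hypergraph

/-! ### Operadic trees and their graphs

Operadic trees are Mathlib's rooted trees: the order is the ancestor order, `⊥` is the root, and
`Order.pred` sends a node to its parent. -/

/-- The edges of a rooted tree. Each one is given by its upper end, which is an arbitrary node other
than the root. -/
structure TreeEdge (T : RootedTree.{u}) where
  /-- The upper end of the edge. -/
  child : T
  child_ne_root : child ≠ ⊥

namespace TreeEdge

variable {T : RootedTree.{u}}

/-- The lower end of an edge. -/
def parent (e : TreeEdge T) : T := Order.pred e.child

/-- The two nodes that an edge joins. -/
def ends (e : TreeEdge T) : Set T := {e.parent, e.child}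

/-- The level of an edge of `T`, as a vertex of the graph of `T`: the distance of its upper end to
the root (the edges at the root have level `1`). -/
noncomputable def level (e : TreeEdge T) : ℕ∞ := Order.height e.child

end TreeEdge

/-- The graph `𝔾(T)`: its vertices are the edges of `T`, and two of them are adjacent if they share
a node of `T`. -/
def graph (T : RootedTree.{u}) : SimpleGraph (TreeEdge T) where
  Adj e f := e ≠ f ∧ (e.ends ∩ f.ends).Nonempty
  symm := ⟨fun _ _ h => ⟨h.1.symm, Set.inter_comm _ _ ▸ h.2⟩⟩
  loopless := ⟨fun _ h => h.1 rfl⟩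

/-- An edge of `𝔾(T)` is solid if the upper end of one of the two tree edges is the lower end of the
other. The remaining edges of `𝔾(T)`, which join siblings, are dashed. -/
def Solid {T : RootedTree.{u}} (e f : TreeEdge T) : Prop :=
  e.child = f.parent ∨ f.child = e.parent

/-- A min-path: a path of minimum length between its end points. -/
def IsMinPath {α : Type u} {G : SimpleGraph α} {x y : α} (p : G.Walk x y) : Prop :=
  p.IsPath ∧ ∀ q : G.Walk x y, q.IsPath → p.length ≤ q.length

/-- All edges of the path `p` in `𝔾(T)` are solid. -/
def AllSolid {T : RootedTree.{u}} {x y : TreeEdge T} (p : (graph T).Walk x y) : Prop :=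
  ∀ d ∈ p.darts, Solid d.fst d.snd

/-! ### Decompositions and associativity arrows

Fully parenthesised words over the nodes of `T` are elements of `FreeMagma T`. In such a word,
`w₁ * w₂` means that the operation denoted by `w₂` is inserted into the one denoted by `w₁`. -/

/-- The set of the nodes of `T` that are ends of an edge in `C`. -/
def nodesOf {T : RootedTree.{u}} (C : Set (TreeEdge T)) : Set T :=
  {a | ∃ e ∈ C, a ∈ e.ends}

open Classical in
/-- The parenthesised word, i.e. the decomposition of the tree, encoded by a construction (or, for
`K ≠ univ`, the decomposition of the subtree with edge set `K`). If the root of the construction is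
labelled with the tree edge `x`, then the insertion along `x` is performed last: the word is
`w₁ * w₂`, where `w₁` and `w₂` decompose the two parts into which the removal of `x` cuts the tree,
the one that contains the lower end of `x` and the one that contains its upper end. Such a part
either is a single node, which is then a letter, or has an edge set that is one of the connected
components, and is decomposed by the subtree of the construction at this component. -/
noncomputable def word {T : RootedTree.{u}} :
    {K : Set (TreeEdge T)} → Construct (ofGraph (graph T)) K → FreeMagma T
  | K, .node Y hne _ sub =>
    let x : TreeEdge T := hne.some -- the only element of `Y`, in a construction
    let part (a : T) : FreeMagma T :=
      if h : ∃ C, IsComponent (ofGraph (graph T)) (K \ Y) C ∧ a ∈ nodesOf C then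
        word (sub h.choose h.choose_spec.1)
      else FreeMagma.of a
    part x.parent * part x.child

/-- Sequential associativity `(w₁w₂)w₃ → w₁(w₂w₃)`, applied to a subword. -/
inductive Beta {A : Type u} : FreeMagma A → FreeMagma A → Prop
  | assoc (w₁ w₂ w₃ : FreeMagma A) : Beta ((w₁ * w₂) * w₃) (w₁ * (w₂ * w₃))
  | left {w w' : FreeMagma A} (z : FreeMagma A) : Beta w w' → Beta (w * z) (w' * z)
  | right {w w' : FreeMagma A} (z : FreeMagma A) : Beta w w' → Beta (z * w) (z * w')

/-- Parallel associativity `(w₁w₂)w₃ → (w₁w₃)w₂`, applied to a subword. -/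
inductive Theta {A : Type u} : FreeMagma A → FreeMagma A → Prop
  | swap (w₁ w₂ w₃ : FreeMagma A) : Theta ((w₁ * w₂) * w₃) ((w₁ * w₃) * w₂)
  | left {w w' : FreeMagma A} (z : FreeMagma A) : Theta w w' → Theta (w * z) (w' * z)
  | right {w w' : FreeMagma A} (z : FreeMagma A) : Theta w w' → Theta (z * w) (z * w')

/-- The constructs of `𝔾(T)`, i.e. the (nonempty) faces of its hypergraph polytope. -/
abbrev Face (T : RootedTree.{u}) : Type u :=
  Construct (ofGraph (graph T)) (ofGraph (graph T)).vertexSet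

/-- The edge `E` is a `β`-arrow from its vertex `V` to its vertex `V'`. -/
def IsBetaArrow {T : RootedTree.{u}} (E V V' : Face T) : Prop :=
  Construct.HasEnds E V V' ∧ Beta (word V) (word V')

/-- The edge `E` is a `θ`-arrow from its vertex `V` to its vertex `V'`. -/
def IsThetaArrow {T : RootedTree.{u}} (E V V' : Face T) : Prop :=
  Construct.HasEnds E V V' ∧ Theta (word V) (word V')

end Operadic

namespace Operadic

universe u

/-! ### Components -/

section Components

variable {α : Type u} {H : Hypergraph α} {G : SimpleGraph α}

/-! Everything is governed by one dichotomy: the upper ends of the tree edges `x` and `y` are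
comparable in the ancestor order (β, solid path) or not (θ, path with a dashed edge).

On the polytope side, the vertices of `E` are its two splittings, with `x` directly below `y` or the
reverse (`IsEdge.isConstruction_and_le_iff`). Below the node `{x, y}` the labels are singletons, so
that node decomposes a connected piece of the tree, which `x` and `y` cut into three parts. If `x`
lies below `y`, the parts form a chain and the splittings read `w₁(w₂w₃)` and `(w₁w₂)w₃`; if the
edges are incomparable, two parts sit on a common lower one and the splittings read `(w₁w₃)w₂` and
`(w₁w₂)w₃`. `word_split_rel` carries the relation down to the root. The cases exclude each other: a
β-step keeps the sequence of letters, while a θ-step changes it because the letters are distinct;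
and β cannot be reversed because `leftWeight` drops.

On the graph side, a walk into the part above a tree edge must pass through that edge. Geodesics are
therefore forced to descend from `x` and from `y` towards the root until the edges coincide or are
siblings; a dashed step occurs exactly in the sibling case (`hasUniqueGeodesic`). -/

theorem edgesIn_mono {X X' : Set α} (h : X ⊆ X') : edgesIn H X ⊆ edgesIn H X' :=
  fun _ hZ => ⟨hZ.1, hZ.2.trans h⟩

/-- Connected subsets of `X` that meet a component of `X` are contained in it. -/
theorem IsConnected.subset_of_isComponent {X C D : Set α} (hC : IsConnected H C) (hCX : C ⊆ X)
    (hD : IsComponent H X D) {a : α} (haC : a ∈ C) (haD : a ∈ D) : C ⊆ D := by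
  by_contra hn
  obtain ⟨b, hb, hbD⟩ := Set.not_subset.1 hn
  -- Since no hyperedge inside `X` crosses the boundary of `D`, cutting `C` along `D` would
  -- disconnect it.
  refine hC.2.2 (C ∩ D) (C \ D) (Set.inter_union_sdiff C D)
    (Set.disjoint_left.2 fun z hz hz' => hz'.2 hz.2) ⟨a, haC, haD⟩ ⟨b, hb, hbD⟩ ?_
  refine subset_antisymm (fun Z hZ => ?_)
    (Set.union_subset (edgesIn_mono Set.inter_subset_left) (edgesIn_mono Set.sdiff_subset))
  have h : Z ∈ edgesIn H X := edgesIn_mono hCX hZ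
  rw [hD.2.2] at h
  exact h.imp (fun h => ⟨h.1, Set.subset_inter hZ.2 h.2⟩)
    (fun h => ⟨h.1, fun z hz => ⟨hZ.2 hz, (h.2 hz).2⟩⟩)

theorem IsComponent.eq_of_mem {X C D : Set α} (hC : IsComponent H X C) (hD : IsComponent H X D)
    {a : α} (haC : a ∈ C) (haD : a ∈ D) : C = D :=
  subset_antisymm (hC.2.1.subset_of_isComponent hC.1 hD haC haD)
    (hD.2.1.subset_of_isComponent hD.1 hC haD haC)

theorem IsComponent.of_subset {X X' C : Set α} (hC : IsComponent H X C) (hX' : X' ⊆ X)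
    (hCX' : C ⊆ X') : IsComponent H X' C := by
  refine ⟨hCX', hC.2.1, subset_antisymm (fun Z hZ => ?_)
    (Set.union_subset (edgesIn_mono hCX') (edgesIn_mono Set.sdiff_subset))⟩
  have h : Z ∈ edgesIn H X := edgesIn_mono hX' hZ
  rw [hC.2.2] at h
  exact h.imp id (fun h => ⟨h.1, fun z hz => ⟨hZ.2 hz, (h.2 hz).2⟩⟩)

/-- A component of `C \ Z`, where `C` is a component of `X`, is a component of `X \ Z`. -/
theorem IsComponent.of_diff {X C D Z : Set α} (hC : IsComponent H X C)
    (hD : IsComponent H (C \ Z) D) : IsComponent H (X \ Z) D := by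
  have hDX : D ⊆ X \ Z := fun d hd => ⟨hC.1 (hD.1 hd).1, (hD.1 hd).2⟩
  refine ⟨hDX, hD.2.1, subset_antisymm (fun W hW => ?_)
    (Set.union_subset (edgesIn_mono hDX) (edgesIn_mono Set.sdiff_subset))⟩
  have h : W ∈ edgesIn H X := edgesIn_mono Set.sdiff_subset hW
  rw [hC.2.2] at h
  rcases h with h | h
  · have h' : W ∈ edgesIn H (C \ Z) := ⟨h.1, fun w hw => ⟨h.2 hw, (hW.2 hw).2⟩⟩
    rw [hD.2.2] at h'
    exact h'.imp id (fun h => ⟨h.1, fun w hw => ⟨hW.2 hw, (h.2 hw).2⟩⟩)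
  · exact Or.inr ⟨h.1, fun w hw => ⟨hW.2 hw, fun hwD => (h.2 hw).2 (hD.1 hwD).1⟩⟩

theorem singleton_mem_edgesIn {X : Set α} {a : α} (ha : a ∈ X) : {a} ∈ edgesIn (ofGraph G) X :=
  ⟨Or.inl ⟨a, rfl⟩, Set.singleton_subset_iff.2 ha⟩

theorem pair_mem_edgesIn {X : Set α} {a b : α} (ha : a ∈ X) (hb : b ∈ X) (h : G.Adj a b) :
    {a, b} ∈ edgesIn (ofGraph G) X :=
  ⟨Or.inr ⟨a, b, h, rfl⟩, Set.insert_subset ha (Set.singleton_subset_iff.2 hb)⟩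

/-- In a graph, the edges inside `X` split along a subset that is closed under adjacency in `X`. -/
theorem edgesIn_eq_union {X C : Set α} (hCX : C ⊆ X)
    (h : ∀ a ∈ C, ∀ b ∈ X, G.Adj a b → b ∈ C) :
    edgesIn (ofGraph G) X = edgesIn (ofGraph G) C ∪ edgesIn (ofGraph G) (X \ C) := by
  refine subset_antisymm ?_
    (Set.union_subset (edgesIn_mono hCX) (edgesIn_mono Set.sdiff_subset))
  rintro Z ⟨⟨a, rfl⟩ | ⟨a, b, hab, rfl⟩, hZX⟩
  · have haX : a ∈ X := hZX rfl
    by_cases haC : a ∈ C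
    · exact Or.inl (singleton_mem_edgesIn haC)
    · exact Or.inr (singleton_mem_edgesIn ⟨haX, haC⟩)
  · have haX : a ∈ X := hZX (Or.inl rfl)
    have hbX : b ∈ X := hZX (Or.inr rfl)
    by_cases haC : a ∈ C
    · exact Or.inl (pair_mem_edgesIn haC (h a haC b hbX hab) hab)
    · exact Or.inr (pair_mem_edgesIn ⟨haX, haC⟩ ⟨hbX, fun hbC => haC (h b hbC a haX hab.symm)⟩ hab)

/-- A property that is preserved along the edges of a connected set holds on all of it if it holds
somewhere. -/
theorem IsConnected.forall_of_adj {X : Set α} (hX : IsConnected (ofGraph G) X) (P : α → Prop)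
    (hP : ∀ a ∈ X, ∀ b ∈ X, G.Adj a b → P a → P b) {a : α} (ha : a ∈ X) (hPa : P a) :
    ∀ b ∈ X, P b := by
  by_contra! hn
  obtain ⟨b, hb, hPb⟩ := hn
  refine hX.2.2 {c ∈ X | P c} (X \ {c ∈ X | P c}) (Set.union_sdiff_cancel fun c hc => hc.1)
    Set.disjoint_sdiff_right ⟨a, ha, hPa⟩ ⟨b, hb, fun h => hPb h.2⟩ ?_
  exact edgesIn_eq_union (fun c hc => hc.1) fun c hc d hd hcd => ⟨hd, hP c hc.1 d hd hcd hc.2⟩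

theorem IsComponent.mem_of_adj {X C : Set α} (hC : IsComponent (ofGraph G) X C) {a b : α}
    (ha : a ∈ C) (hb : b ∈ X) (hab : G.Adj a b) : b ∈ C := by
  have h := pair_mem_edgesIn (hC.1 ha) hb hab
  rw [hC.2.2] at h
  rcases h with h | h
  · exact h.2 (Or.inr rfl)
  · exact absurd ha (h.2 (Or.inl rfl)).2

/-- A set in which every vertex is reachable from a fixed one is connected. -/
theorem isConnected_of_reachable {C : Set α} {a : α} (ha : a ∈ C)
    (h : ∀ b ∈ C, Relation.ReflTransGen (fun c d => G.Adj c d ∧ d ∈ C) a b) :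
    IsConnected (ofGraph G) C := by
  refine ⟨Set.subset_univ _, ⟨a, ha⟩, ?_⟩
  have key : ∀ X₁ X₂ : Set α, X₁ ∪ X₂ = C → Disjoint X₁ X₂ → X₂.Nonempty → a ∈ X₁ →
      edgesIn (ofGraph G) C ≠ edgesIn (ofGraph G) X₁ ∪ edgesIn (ofGraph G) X₂ := by
    rintro X₁ X₂ hU hdisj ⟨b, hb⟩ ha₁ heq
    have hr : ∀ c, Relation.ReflTransGen (fun c d => G.Adj c d ∧ d ∈ C) a c → c ∈ X₁ := by
      intro c hc
      induction hc with
      | refl => exact ha₁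
      | @tail c d _ hcd ih =>
        have hm := pair_mem_edgesIn (hU ▸ Or.inl ih) hcd.2 hcd.1
        rw [heq] at hm
        rcases hm with hm | hm
        · exact hm.2 (Or.inr rfl)
        · exact absurd (hm.2 (Or.inl rfl)) (Set.disjoint_left.1 hdisj ih)
    exact Set.disjoint_left.1 hdisj (hr b (h b (hU ▸ Or.inr hb))) hb
  intro X₁ X₂ hU hdisj h₁ h₂
  rcases (hU ▸ ha : a ∈ X₁ ∪ X₂) with h | h
  · exact key X₁ X₂ hU hdisj h₂ h
  · rw [Set.union_comm (edgesIn _ X₁)]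
    exact key X₂ X₁ (Set.union_comm X₁ X₂ ▸ hU) hdisj.symm h₁ h

/-- The component is the set of vertices reachable from `a` inside `X`; no finiteness is involved.
-/
theorem exists_isComponent {X : Set α} {a : α} (ha : a ∈ X) :
    ∃ C, IsComponent (ofGraph G) X C ∧ a ∈ C := by
  let C : Set α := {b | Relation.ReflTransGen (fun c d => G.Adj c d ∧ d ∈ X) a b}
  have hCX : C ⊆ X := by
    intro b hb
    induction (show Relation.ReflTransGen _ a b from hb) with
    | refl => exact ha
    | tail _ h _ => exact h.2
  refine ⟨C, ⟨hCX, isConnected_of_reachable (a := a) Relation.ReflTransGen.refl ?_, ?_⟩,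
    Relation.ReflTransGen.refl⟩
  · intro b hb
    induction (show Relation.ReflTransGen _ a b from hb) with
    | refl => exact Relation.ReflTransGen.refl
    | @tail c d hc h ih => exact (ih hc).tail ⟨h.1, hb⟩
  · exact edgesIn_eq_union hCX fun b hb c hc hbc => Relation.ReflTransGen.tail hb ⟨hbc, hc⟩

end Components

/-! ### Labels -/

namespace Construct

section Labels

variable {α : Type u} {H : Hypergraph α}

theorem nonempty_and_subset_of_mem_labels {K : Set α} (S : Construct H K) :
    ∀ Y ∈ S.labels, Y.Nonempty ∧ Y ⊆ K := by
  induction S with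
  | @node K Y hne hsub sub ih =>
    rintro Z (rfl | ⟨C, hC, hZ⟩)
    · exact ⟨hne, hsub⟩
    · exact ⟨(ih C hC Z hZ).1, (ih C hC Z hZ).2.trans (hC.1.trans Set.sdiff_subset)⟩

/-- The label of the root occurs only once. -/
theorem notMem_labels_sub {K Y : Set α} (hne : Y.Nonempty) {C : Set α}
    (hC : IsComponent H (K \ Y) C) (S : Construct H C) : Y ∉ S.labels := fun h =>
  let ⟨_, hy⟩ := hne
  (hC.1 ((S.nonempty_and_subset_of_mem_labels Y h).2 hy)).2 hy

/-- Labels are nonempty and sibling subtrees live on disjoint components, so a label determines its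
branch. This is why only one branch changes when a node is split. -/
theorem eq_of_mem_labels {K Y Z C D : Set α} (hC : IsComponent H (K \ Y) C)
    (hD : IsComponent H (K \ Y) D) {S : Construct H C} {S' : Construct H D}
    (h : Z ∈ S.labels) (h' : Z ∈ S'.labels) : C = D :=
  let ⟨⟨_, hz⟩, hZC⟩ := S.nonempty_and_subset_of_mem_labels Z h
  hC.eq_of_mem hD (hZC hz) ((S'.nonempty_and_subset_of_mem_labels Z h').2 hz)

theorem Below.mem_labels {A B : Set α} {K : Set α} {S : Construct H K} (h : S.Below A B) :
    A ∈ S.labels ∧ B ∈ S.labels := by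
  induction S with
  | node Y hne hsub sub ih =>
    rcases h with ⟨rfl, C, hC, hB⟩ | ⟨C, hC, h⟩
    · exact ⟨Or.inl rfl, Or.inr ⟨C, hC, hB⟩⟩
    · exact ⟨Or.inr ⟨C, hC, (ih C hC h).1⟩, Or.inr ⟨C, hC, (ih C hC h).2⟩⟩

theorem Below.asymm {A B : Set α} {K : Set α} {S : Construct H K} (h : S.Below A B) :
    ¬ S.Below B A := by
  induction S with
  | node Y hne hsub sub ih =>
    rcases h with ⟨rfl, C, hC, hB⟩ | ⟨C, hC, h⟩ <;> rintro (⟨rfl, D, hD, hA⟩ | ⟨D, hD, h'⟩)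
    · exact notMem_labels_sub hne hC _ hB
    · exact notMem_labels_sub hne hD _ h'.mem_labels.2
    · exact notMem_labels_sub hne hC _ h.mem_labels.2
    · obtain rfl := eq_of_mem_labels hC hD h.mem_labels.1 h'.mem_labels.2
      exact ih C hC h h'

theorem IsConstruction.sub {K Y : Set α} {hne : Y.Nonempty} {hsub : Y ⊆ K}
    {sub : ∀ C : Set α, IsComponent H (K \ Y) C → Construct H C}
    (h : (node Y hne hsub sub).IsConstruction) (C : Set α) (hC) : (sub C hC).IsConstruction :=
  fun Z hZ => h Z (Or.inr ⟨C, hC, hZ⟩)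

theorem IsEdge.symm {K : Set α} {E : Construct H K} {x y : α} (h : E.IsEdge x y) :
    E.IsEdge y x := by
  unfold IsEdge
  rw [Set.pair_comm]
  exact ⟨h.1.symm, h.2⟩

theorem IsEdge.sub_isConstruction {K Y : Set α} {x y : α} {hne : Y.Nonempty} {hsub : Y ⊆ K}
    {sub : ∀ C : Set α, IsComponent H (K \ Y) C → Construct H C}
    (h : (node Y hne hsub sub).IsEdge x y) (C : Set α) (hC) (hn : {x, y} ∉ (sub C hC).labels) :
    (sub C hC).IsConstruction :=
  fun Z hZ => h.2.2 Z (Or.inr ⟨C, hC, hZ⟩) fun he => hn (he ▸ hZ)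

theorem IsEdge.sub_isEdge {K Y : Set α} {x y : α} {hne : Y.Nonempty} {hsub : Y ⊆ K}
    {sub : ∀ C : Set α, IsComponent H (K \ Y) C → Construct H C}
    (h : (node Y hne hsub sub).IsEdge x y) (C : Set α) (hC) (hm : {x, y} ∈ (sub C hC).labels) :
    (sub C hC).IsEdge x y :=
  ⟨h.1, hm, fun Z hZ => h.2.2 Z (Or.inr ⟨C, hC, hZ⟩)⟩

theorem pair_ne_singleton {x y : α} (hxy : x ≠ y) (z : α) : ({x, y} : Set α) ≠ {z} := fun h =>
  hxy ((h ▸ Or.inl rfl : x ∈ ({z} : Set α)).trans (h ▸ Or.inr rfl : y ∈ ({z} : Set α)).symm)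

end Labels

/-! ### Splitting a two-element node -/

section Split

variable {α : Type u} {H : Hypergraph α}

/-- Together with the next lemma, this allows the subtrees over `K \ {x, y}` to be reused when `x`
and `y` are removed one after the other. -/
theorem isComponent_pair_of_mem {K C D : Set α} {x y : α} (hC : IsComponent H (K \ {x}) C)
    (hD : IsComponent H (C \ {y}) D) : IsComponent H (K \ {x, y}) D := by
  have h := hC.of_diff hD
  rwa [Set.sdiff_sdiff, Set.singleton_union] at h

theorem isComponent_pair_of_notMem {K C : Set α} {x y : α} (hC : IsComponent H (K \ {x}) C)
    (hy : y ∉ C) : IsComponent H (K \ {x, y}) C :=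
  hC.of_subset (Set.sdiff_subset_sdiff_right (Set.singleton_subset_iff.2 (Or.inl rfl))) fun _ hc =>
    ⟨(hC.1 hc).1, fun h => h.elim (hC.1 hc).2 fun h => hy (h ▸ hc)⟩

open Classical in
/-- Replace the node of a construct labelled with `{x, y}` by a node labelled with `{x}` and, on
top of it, a node labelled with `{y}`. -/
noncomputable def split (x y : α) : {K : Set α} → Construct H K → Construct H K
  | _, node Y hne hsub sub =>
    if h : Y = {x, y} then
      node {x} (Set.singleton_nonempty x)
        (Set.singleton_subset_iff.2 (hsub (h ▸ Or.inl rfl))) fun C hC =>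
          if hy : y ∈ C then
            node {y} (Set.singleton_nonempty y) (Set.singleton_subset_iff.2 hy) fun D hD =>
              sub D (h ▸ isComponent_pair_of_mem hC hD)
          else sub C (h ▸ isComponent_pair_of_notMem hC hy)
    else node Y hne hsub fun C hC => split x y (sub C hC)

open Classical in
theorem split_pair {K : Set α} (x y : α) (hne : ({x, y} : Set α).Nonempty)
    (hsub : {x, y} ⊆ K)
    (sub : ∀ C : Set α, IsComponent H (K \ {x, y}) C → Construct H C) :
    split x y (node {x, y} hne hsub sub) =
      node {x} (Set.singleton_nonempty x)
        (Set.singleton_subset_iff.2 (hsub (Or.inl rfl))) fun C hC =>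
          if hy : y ∈ C then
            node {y} (Set.singleton_nonempty y) (Set.singleton_subset_iff.2 hy) fun D hD =>
              sub D (isComponent_pair_of_mem hC hD)
          else sub C (isComponent_pair_of_notMem hC hy) := by
  rw [split, dif_pos rfl]

theorem split_of_ne {K Y : Set α} {x y : α} (hY : Y ≠ {x, y}) (hne : Y.Nonempty)
    (hsub : Y ⊆ K) (sub : ∀ C : Set α, IsComponent H (K \ Y) C → Construct H C) :
    split x y (node Y hne hsub sub) = node Y hne hsub fun C hC => split x y (sub C hC) := by
  rw [split, dif_neg hY]

theorem split_eq_self {x y : α} {K : Set α} {S : Construct H K} (hS : {x, y} ∉ S.labels) :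
    split x y S = S := by
  induction S with
  | node Y hne hsub sub ih =>
    rw [split_of_ne fun h => hS (Or.inl h.symm)]
    congr
    funext C hC
    exact ih C hC fun h => hS (Or.inr ⟨C, hC, h⟩)

theorem IsConstruction.pair_notMem {x y : α} (hxy : x ≠ y) {K : Set α} {V : Construct H K}
    (hV : V.IsConstruction) : {x, y} ∉ V.labels := fun h =>
  let ⟨z, hz⟩ := hV _ h
  pair_ne_singleton hxy z hz

theorem split_isConstruction {x y : α} {K : Set α} {E : Construct H K} (hE : E.IsEdge x y) :
    (split x y E).IsConstruction := by
  induction E with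
  | node Y hne hsub sub ih =>
    by_cases hY : Y = {x, y}
    · subst hY
      have hs : ∀ C hC, (sub C hC).IsConstruction := fun C hC =>
        hE.sub_isConstruction C hC (notMem_labels_sub hne hC _)
      rw [split_pair]
      rintro Z (rfl | ⟨C, hC, hZ⟩)
      · exact ⟨x, rfl⟩
      · beta_reduce at hZ
        split_ifs at hZ with hy
        · rcases hZ with rfl | ⟨D, hD, hZ⟩
          · exact ⟨y, rfl⟩
          · exact hs _ _ Z hZ
        · exact hs _ _ Z hZ
    · rw [split_of_ne hY]
      rintro Z (rfl | ⟨C, hC, hZ⟩)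
      · exact hE.2.2 Z (Or.inl rfl) hY
      · by_cases hm : {x, y} ∈ (sub C hC).labels
        · exact ih C hC (hE.sub_isEdge C hC hm) Z hZ
        · beta_reduce at hZ
          rw [split_eq_self hm] at hZ
          exact hE.sub_isConstruction C hC hm Z hZ

/-- A construct below an edge `E` of the polytope is `E` or one of the two splittings of `E`, and a
construct below a vertex is this vertex. -/
theorem Le.eq_or_eq_split {x y : α} {K : Set α} {S U : Construct H K} (h : Le S U) :
    (U.IsConstruction → S = U) ∧
      (U.IsEdge x y → S = U ∨ S = split x y U ∨ S = split y x U) := by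
  induction h with
  | refl S => exact ⟨fun _ => rfl, fun _ => Or.inl rfl⟩
  | trans _ _ ih₁ ih₂ =>
    refine ⟨fun h => ?_, fun h => ?_⟩
    · obtain rfl := ih₂.1 h
      exact ih₁.1 h
    -- A splitting is a construction, and nothing lies strictly below a construction, so the chain
    -- stops there.
    · rcases ih₂.2 h with rfl | rfl | rfl
      · exact ih₁.2 h
      · exact Or.inr (Or.inl (ih₁.1 (split_isConstruction h)))
      · exact Or.inr (Or.inr (ih₁.1 (split_isConstruction h.symm)))
  | @contract K Y X C₀ hne hsub sub hne₀ hsub₀ sub₀ hneU hsubU subU h₀ hX hin hout =>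
    obtain ⟨a, ha⟩ := hne
    obtain ⟨b, hb⟩ := hne₀
    have hdisj : ∀ c ∈ Y, c ∉ X := fun c hc hc' => (h₀.1 (hsub₀ hc')).2 hc
    have hab : a ≠ b := fun h => hdisj a ha (h ▸ hb)
    -- A merged label has at least two elements: it never occurs in a construction, and in an edge
    -- it must be the pair.
    have hns : ∀ z, Y ∪ X ≠ {z} := fun z hz => hab
      ((hz ▸ Or.inl ha : a ∈ ({z} : Set α)).trans (hz ▸ Or.inr hb : b ∈ ({z} : Set α)).symm)
    refine ⟨fun h => ?_, fun h => Or.inr ?_⟩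
    · obtain ⟨z, hz⟩ := h _ (Or.inl rfl)
      exact absurd hz (hns z)
    · have hYX : Y ∪ X = {x, y} := by
        by_contra hn
        obtain ⟨z, hz⟩ := h.2.2 _ (Or.inl rfl) hn
        exact hns z hz
      have key : ∀ x y : α, Y = {x} → X = {y} → node Y ⟨a, ha⟩ hsub sub =
          split x y (node (Y ∪ X) hneU hsubU subU) := by
        rintro x y rfl rfl
        -- The label is generalised to `Y'` because the type of `subU` depends on `Y ∪ X`, which is
        -- equal to the pair only propositionally.
        have hU : ∀ (Y' : Set α) (hY' : Y' = {x, y}) (hne' : Y'.Nonempty) (hsub' : Y' ⊆ K)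
            (sub' : ∀ C : Set α, IsComponent H (K \ Y') C → Construct H C),
            (∀ C h' (h : IsComponent H (C₀ \ {y}) C), sub' C h' = sub₀ C h) →
            (∀ C h' (h : IsComponent H (K \ {x}) C), sub' C h' = sub C h) →
            node {x} ⟨a, ha⟩ hsub sub = split x y (node Y' hne' hsub' sub') := by
          rintro Y' rfl hne' hsub' sub' hin hout
          rw [split_pair]
          congr
          funext C hC
          split_ifs with hy
          · obtain rfl := hC.eq_of_mem h₀ hy (hsub₀ rfl)
            rw [hX]
            congr
            funext D hD
            exact (hin D _ hD).symm
          · exact (hout C _ hC).symm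
        exact hU _ Set.singleton_union hneU hsubU subU hin hout
      have hY : ∀ c ∈ Y, c = x ∨ c = y := fun c hc => by
        have : c ∈ ({x, y} : Set α) := hYX ▸ Or.inl hc
        simpa using this
      have hX' : ∀ c ∈ X, c = x ∨ c = y := fun c hc => by
        have : c ∈ ({x, y} : Set α) := hYX ▸ Or.inr hc
        simpa using this
      rcases hY a ha with rfl | rfl
      · obtain rfl : b = y := (hX' b hb).resolve_left (Ne.symm hab)
        refine Or.inl (key a b ?_ ?_)
        · exact subset_antisymm (fun c hc => (hY c hc).resolve_right fun h => hdisj c hc (h ▸ hb))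
            (Set.singleton_subset_iff.2 ha)
        · exact subset_antisymm (fun c hc => (hX' c hc).resolve_left fun h =>
            hdisj a ha (h ▸ hc)) (Set.singleton_subset_iff.2 hb)
      · obtain rfl : b = x := (hX' b hb).resolve_right (Ne.symm hab)
        refine Or.inr (key a b ?_ ?_)
        · exact subset_antisymm (fun c hc => (hY c hc).resolve_left fun h => hdisj c hc (h ▸ hb))
            (Set.singleton_subset_iff.2 ha)
        · exact subset_antisymm (fun c hc => (hX' c hc).resolve_right fun h =>
            hdisj a ha (h ▸ hc)) (Set.singleton_subset_iff.2 hb)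
  | @congr K Y C₀ hne hsub sub sub' h₀ _ hrest ih =>
    refine ⟨fun h => ?_, fun h => ?_⟩
    · congr
      funext C hC
      by_cases hCC : C = C₀
      · subst hCC
        exact ih.1 (h.sub C hC)
      · exact hrest C hC hCC
    · by_cases hm : {x, y} ∈ (sub' C₀ h₀).labels
      · have hY : Y ≠ {x, y} := by
          rintro rfl
          exact notMem_labels_sub hne h₀ _ hm
        have hrest' : ∀ C hC, C ≠ C₀ → {x, y} ∉ (sub' C hC).labels := fun C hC hCC hm' =>
          hCC (eq_of_mem_labels hC h₀ hm' hm)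
        rcases ih.2 (h.sub_isEdge _ _ hm) with h' | h' | h'
        · left
          congr
          funext C hC
          by_cases hCC : C = C₀
          · subst hCC
            exact h'
          · exact hrest C hC hCC
        · right; left
          rw [split_of_ne hY]
          congr
          funext C hC
          by_cases hCC : C = C₀
          · subst hCC
            exact h'
          · rw [split_eq_self (hrest' C hC hCC)]
            exact hrest C hC hCC
        · right; right
          rw [Set.pair_comm] at hY
          rw [split_of_ne hY]
          congr
          funext C hC
          by_cases hCC : C = C₀
          · subst hCC
            exact h'
          · rw [split_eq_self (Set.pair_comm x y ▸ hrest' C hC hCC)]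
            exact hrest C hC hCC
      · left
        congr
        funext C hC
        by_cases hCC : C = C₀
        · subst hCC
          exact ih.1 (h.sub_isConstruction C hC hm)
        · exact hrest C hC hCC

variable {G : SimpleGraph α}

theorem split_le {x y : α} {K : Set α} {E : Construct (ofGraph G) K} (hE : E.IsEdge x y) :
    Le (split x y E) E := by
  induction E with
  | @node K Y hne hsub sub ih =>
    by_cases hY : Y = {x, y}
    · subst hY
      rw [split_pair]
      obtain ⟨C₀, h₀, hy⟩ := exists_isComponent (G := G) (X := K \ {x}) (a := y)
        ⟨hsub (Or.inr rfl), hE.1.symm⟩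
      exact Le.contract (X := {y}) (sub₀ := fun D hD => sub D (isComponent_pair_of_mem h₀ hD))
        (hsubU := hsub) (subU := sub) (hneU := hne) (hsub₀ := Set.singleton_subset_iff.2 hy)
        (hne₀ := Set.singleton_nonempty y) h₀ (dif_pos hy)
        (fun C hU h => rfl) (fun C hU h => by
          rw [dif_neg fun hyC => (hU.1 hyC).2 (Or.inr rfl)])
    · rw [split_of_ne hY]
      obtain ⟨C, hC, hm⟩ := hE.2.1.resolve_left (Ne.symm hY)
      refine Le.congr hC (ih C hC (hE.sub_isEdge C hC hm)) fun D hD hDC => split_eq_self fun hm' =>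
        hDC (eq_of_mem_labels hD hC hm' hm)

theorem split_below {x y : α} (hxy : x ≠ y) {K : Set α} {E : Construct (ofGraph G) K}
    (hE : {x, y} ∈ E.labels) : (split x y E).Below {x} {y} := by
  induction E with
  | @node K Y hne hsub sub ih =>
    by_cases hY : Y = {x, y}
    · subst hY
      rw [split_pair]
      obtain ⟨C₀, h₀, hy⟩ := exists_isComponent (G := G) (X := K \ {x}) (a := y)
        ⟨hsub (Or.inr rfl), hxy.symm⟩
      refine Or.inl ⟨rfl, C₀, h₀, ?_⟩
      beta_reduce
      rw [dif_pos hy]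
      exact Or.inl rfl
    · rw [split_of_ne hY]
      obtain ⟨C, hC, hm⟩ := hE.resolve_left (Ne.symm hY)
      exact Or.inr ⟨C, hC, ih C hC hm⟩

/-- Of the three constructs that can lie below `E`, only `E` itself fails to be a construction,
because of its two-element label. -/
theorem IsEdge.isConstruction_and_le_iff {x y : α} {K : Set α} {E : Construct (ofGraph G) K}
    (hE : E.IsEdge x y) (W : Construct (ofGraph G) K) :
    (W.IsConstruction ∧ Le W E) ↔ (W = split x y E ∨ W = split y x E) := by
  constructor
  · rintro ⟨hW, hle⟩
    refine (hle.eq_or_eq_split.2 hE).resolve_left ?_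
    rintro rfl
    exact hW.pair_notMem hE.1 hE.2.1
  · rintro (rfl | rfl)
    · exact ⟨split_isConstruction hE, split_le hE⟩
    · exact ⟨split_isConstruction hE.symm, split_le hE.symm⟩

end Split

end Construct

/-! ### Edges of rooted trees -/

section Trees

variable {T : RootedTree.{u}}

namespace TreeEdge

theorem eq_of_child_eq {e f : TreeEdge T} (h : e.child = f.child) : e = f := by
  cases e
  cases f
  congr

theorem parent_lt_child (e : TreeEdge T) : e.parent < e.child :=
  Order.pred_lt_of_not_isMin fun h => e.child_ne_root h.eq_bot

theorem parent_mem_ends (e : TreeEdge T) : e.parent ∈ e.ends := Or.inl rfl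

theorem child_mem_ends (e : TreeEdge T) : e.child ∈ e.ends := Or.inr rfl

theorem le_parent_of_lt_child {e : TreeEdge T} {a : T} (h : a < e.child) : a ≤ e.parent :=
  Order.le_pred_of_lt h

/-- The ends of an edge other than `x` are on the same side of `x`. -/
theorem child_le_iff_of_mem_ends {x e : TreeEdge T} (hne : e ≠ x) {a : T} (ha : a ∈ e.ends) :
    x.child ≤ a ↔ x.child ≤ e.child := by
  rcases ha with rfl | rfl
  · exact ⟨fun h => h.trans e.parent_lt_child.le, fun h =>
      le_parent_of_lt_child (h.lt_of_ne fun h' => hne (eq_of_child_eq h'.symm))⟩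
  · rfl

/-- Lying above `x` is a property of nodes on which the two ends of any other edge agree, so it
passes through a shared node. -/
theorem child_le_child_iff_of_adj {x e f : TreeEdge T} (he : e ≠ x) (hf : f ≠ x)
    (h : (graph T).Adj e f) : x.child ≤ e.child ↔ x.child ≤ f.child := by
  obtain ⟨a, hae, haf⟩ := h.2
  rw [← child_le_iff_of_mem_ends he hae, child_le_iff_of_mem_ends hf haf]

end TreeEdge

theorem graph_adj_of_mem_ends {e f : TreeEdge T} (hne : e ≠ f) {a : T} (he : a ∈ e.ends)
    (hf : a ∈ f.ends) : (graph T).Adj e f := ⟨hne, a, he, hf⟩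

theorem IsComponent.mem_of_mem_ends {X C : Set (TreeEdge T)}
    (hC : IsComponent (ofGraph (graph T)) X C) {e f : TreeEdge T} (he : e ∈ C) (hf : f ∈ X) {a : T}
    (hae : a ∈ e.ends) (haf : a ∈ f.ends) : f ∈ C := by
  by_cases h : e = f
  · exact h ▸ he
  · exact hC.mem_of_adj he hf (graph_adj_of_mem_ends h hae haf)

/-- Edges that meet at a node are adjacent, so components do not share nodes. This makes the choice
of component in `word` immaterial. -/
theorem IsComponent.eq_of_mem_nodesOf {X C D : Set (TreeEdge T)}
    (hC : IsComponent (ofGraph (graph T)) X C) (hD : IsComponent (ofGraph (graph T)) X D) {a : T}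
    (haC : a ∈ nodesOf C) (haD : a ∈ nodesOf D) : C = D := by
  obtain ⟨e, he, hae⟩ := haC
  obtain ⟨f, hf, haf⟩ := haD
  exact hC.eq_of_mem hD (hC.mem_of_mem_ends he (hD.1 hf) hae haf) hf

/-- The nodes of a connected set of edges are on the same side of any edge outside this set. -/
theorem IsConnected.child_le_iff {C : Set (TreeEdge T)} (hC : IsConnected (ofGraph (graph T)) C)
    {x : TreeEdge T} (hx : x ∉ C) {a b : T} (ha : a ∈ nodesOf C) (hb : b ∈ nodesOf C) :
    x.child ≤ a ↔ x.child ≤ b := by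
  obtain ⟨e, he, hae⟩ := ha
  obtain ⟨f, hf, hbf⟩ := hb
  have hne : ∀ g ∈ C, g ≠ x := fun g hg h => hx (h ▸ hg)
  rw [TreeEdge.child_le_iff_of_mem_ends (hne e he) hae,
    TreeEdge.child_le_iff_of_mem_ends (hne f hf) hbf]
  exact hC.forall_of_adj (fun g => x.child ≤ e.child ↔ x.child ≤ g.child)
    (fun g hg g' hg' h hP => hP.trans
      (TreeEdge.child_le_child_iff_of_adj (hne g hg) (hne g' hg') h)) he Iff.rfl f hf

/-- Every component that is left when an edge `x` is removed from a connected set has an end of `x`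
as a node. -/
theorem IsComponent.parent_or_child_mem {K C : Set (TreeEdge T)}
    (hK : IsConnected (ofGraph (graph T)) K) {x : TreeEdge T} (hx : x ∈ K)
    (hC : IsComponent (ofGraph (graph T)) (K \ {x}) C) :
    x.parent ∈ nodesOf C ∨ x.child ∈ nodesOf C := by
  by_contra hn
  push Not at hn
  obtain ⟨c, hc⟩ := hC.2.1.2.1
  -- If `C` touched neither end of `x`, it would be closed under adjacency in `K` and would
  -- therefore contain `x`.
  refine (hC.1 (hK.forall_of_adj (· ∈ C) (fun a _ b hb hab haC => ?_) (hC.1 hc).1 hc x hx)).2 rfl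
  by_cases hbx : b = x
  · obtain ⟨n, hna, hnb⟩ := hab.2
    subst hbx
    rcases hnb with rfl | rfl
    · exact absurd ⟨a, haC, hna⟩ hn.1
    · exact absurd ⟨a, haC, hna⟩ hn.2
  · exact hC.mem_of_adj haC ⟨hb, hbx⟩ hab

section Side

variable {K C : Set (TreeEdge T)} {x y : TreeEdge T}

/-- A component lies entirely on one side of `x` and touches `x` at the end on that side; any of its
edges, here `y`, tells which. -/
theorem IsComponent.parent_mem_iff (hK : IsConnected (ofGraph (graph T)) K) (hx : x ∈ K)
    (hC : IsComponent (ofGraph (graph T)) (K \ {x}) C) (hy : y ∈ C) :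
    x.parent ∈ nodesOf C ↔ ¬ x.child ≤ y.child := by
  have hxC : x ∉ C := fun h => (hC.1 h).2 rfl
  have hyC : y.child ∈ nodesOf C := ⟨y, hy, y.child_mem_ends⟩
  refine ⟨fun h => ?_, fun h => (hC.parent_or_child_mem hK hx).resolve_right fun h' => ?_⟩
  · rw [← hC.2.1.child_le_iff hxC h hyC]
    exact x.parent_lt_child.not_ge
  · exact h ((hC.2.1.child_le_iff hxC h' hyC).1 le_rfl)

theorem IsComponent.child_mem_iff (hK : IsConnected (ofGraph (graph T)) K) (hx : x ∈ K)
    (hC : IsComponent (ofGraph (graph T)) (K \ {x}) C) (hy : y ∈ C) :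
    x.child ∈ nodesOf C ↔ x.child ≤ y.child := by
  have hxC : x ∉ C := fun h => (hC.1 h).2 rfl
  have hyC : y.child ∈ nodesOf C := ⟨y, hy, y.child_mem_ends⟩
  refine ⟨fun h => (hC.2.1.child_le_iff hxC h hyC).1 le_rfl, fun h => ?_⟩
  refine (hC.parent_or_child_mem hK hx).resolve_left fun h' => ?_
  exact (hC.parent_mem_iff hK hx hy).1 h' h

end Side

end Trees

/-! ### Words -/

section Words

variable {T : RootedTree.{u}}

open Classical in
/-- The word of the part of the tree that contains the node `a`. -/
noncomputable def wordAt {X : Set (TreeEdge T)}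
    (sub : ∀ C, IsComponent (ofGraph (graph T)) X C → Construct (ofGraph (graph T)) C) (a : T) :
    FreeMagma T :=
  if h : ∃ C, IsComponent (ofGraph (graph T)) X C ∧ a ∈ nodesOf C then
    word (sub h.choose h.choose_spec.1)
  else FreeMagma.of a

theorem word_node {K Y : Set (TreeEdge T)} (hne : Y.Nonempty) (hsub : Y ⊆ K)
    (sub : ∀ C, IsComponent (ofGraph (graph T)) (K \ Y) C → Construct (ofGraph (graph T)) C) :
    word (.node Y hne hsub sub) = wordAt sub hne.some.parent * wordAt sub hne.some.child := by
  rw [word]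
  rfl

theorem word_node_singleton {K : Set (TreeEdge T)} {x : TreeEdge T}
    (hne : ({x} : Set (TreeEdge T)).Nonempty) (hsub : {x} ⊆ K)
    (sub : ∀ C, IsComponent (ofGraph (graph T)) (K \ {x}) C → Construct (ofGraph (graph T)) C) :
    word (.node {x} hne hsub sub) = wordAt sub x.parent * wordAt sub x.child := by
  rw [word_node, Set.mem_singleton_iff.1 hne.some_mem]

section WordAt

variable {X X' : Set (TreeEdge T)}
  {sub : ∀ C, IsComponent (ofGraph (graph T)) X C → Construct (ofGraph (graph T)) C}
  {sub' : ∀ C, IsComponent (ofGraph (graph T)) X' C → Construct (ofGraph (graph T)) C}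

theorem wordAt_of_mem {C : Set (TreeEdge T)} (hC : IsComponent (ofGraph (graph T)) X C) {a : T}
    (ha : a ∈ nodesOf C) : wordAt sub a = word (sub C hC) := by
  have h : ∃ C, IsComponent (ofGraph (graph T)) X C ∧ a ∈ nodesOf C := ⟨C, hC, ha⟩
  rw [wordAt, dif_pos h]
  have hCC : h.choose = C := h.choose_spec.1.eq_of_mem_nodesOf hC h.choose_spec.2 ha
  congr!

theorem wordAt_of_forall_notMem {a : T}
    (ha : ∀ C, IsComponent (ofGraph (graph T)) X C → a ∉ nodesOf C) :
    wordAt sub a = FreeMagma.of a :=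
  dif_neg fun ⟨C, hC, h⟩ => ha C hC h

/-- The second hypothesis handles a part that is a single node: no edge of `X'` may touch `a` when
no edge of `X` does. -/
theorem wordAt_congr {a : T}
    (h₁ : ∀ C hC, a ∈ nodesOf C → ∃ hC', sub' C hC' = sub C hC)
    (h₂ : ∀ e ∈ X', a ∈ e.ends → e ∈ X) : wordAt sub a = wordAt sub' a := by
  by_cases h : ∃ C, IsComponent (ofGraph (graph T)) X C ∧ a ∈ nodesOf C
  · obtain ⟨C, hC, ha⟩ := h
    obtain ⟨hC', he⟩ := h₁ C hC ha
    rw [wordAt_of_mem hC ha, wordAt_of_mem hC' ha, he]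
  · rw [wordAt_of_forall_notMem fun C hC ha => h ⟨C, hC, ha⟩, wordAt_of_forall_notMem]
    rintro C hC ⟨e, he, ha⟩
    obtain ⟨D, hD, heD⟩ := exists_isComponent (G := graph T) (h₂ e (hC.1 he) ha)
    exact h ⟨D, hD, e, heD, ha⟩

end WordAt

/-! ### Words of the two splittings at the root -/

section WordSplit

open Construct

variable {K Y : Set (TreeEdge T)} {x y : TreeEdge T}
  {sub : ∀ C, IsComponent (ofGraph (graph T)) (K \ Y) C → Construct (ofGraph (graph T)) C}

open Classical in
/-- The word of the splitting `x(y(…),…)` of a construct with root `{x, y}`, where `C₀` is the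
component that contains `y` after the removal of `x`. -/
theorem word_split_root (hY : Y = {x, y}) (hne : Y.Nonempty) (hsub : Y ⊆ K)
    {C₀ : Set (TreeEdge T)} (h₀ : IsComponent (ofGraph (graph T)) (K \ {x}) C₀) (hy : y ∈ C₀) :
    word (split x y (node Y hne hsub sub)) =
      (if x.parent ∈ nodesOf C₀ then wordAt sub y.parent * wordAt sub y.child
        else wordAt sub x.parent) *
      (if x.child ∈ nodesOf C₀ then wordAt sub y.parent * wordAt sub y.child
        else wordAt sub x.child) := by
  subst hY
  rw [split_pair, word_node_singleton]
  -- Only the part that contains `y` is cut further; every other part keeps its subtree.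
  have key : ∀ a : T, wordAt (X := K \ {x}) (fun C hC =>
      if hy : y ∈ C then
        node {y} (Set.singleton_nonempty y) (Set.singleton_subset_iff.2 hy) fun D hD =>
          sub D (isComponent_pair_of_mem hC hD)
      else sub C (isComponent_pair_of_notMem hC hy)) a =
      if a ∈ nodesOf C₀ then wordAt sub y.parent * wordAt sub y.child else wordAt sub a := by
    intro a
    split_ifs with ha
    · rw [wordAt_of_mem h₀ ha, dif_pos hy, word_node_singleton]
      have h : ∀ b ∈ y.ends, wordAt (X := C₀ \ {y}) (fun D hD =>
          sub D (isComponent_pair_of_mem h₀ hD)) b = wordAt sub b := fun b hb =>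
        wordAt_congr (fun C hC _ => ⟨isComponent_pair_of_mem h₀ hC, rfl⟩) fun e he hbe =>
          ⟨h₀.mem_of_mem_ends hy ⟨he.1, fun h => he.2 (Or.inl h)⟩ hb hbe,
            fun h => he.2 (Or.inr h)⟩
      rw [h _ y.parent_mem_ends, h _ y.child_mem_ends]
    · refine wordAt_congr (fun C hC haC => ?_) fun e he _ => ⟨he.1, fun h => he.2 (Or.inl h)⟩
      have hyC : y ∉ C := fun hyC => ha (hC.eq_of_mem h₀ hyC hy ▸ haC)
      exact ⟨isComponent_pair_of_notMem hC hyC, by rw [dif_neg hyC]⟩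
  rw [key, key]

theorem word_split_root_of_le (hK : IsConnected (ofGraph (graph T)) K) (hxy : x ≠ y)
    (hY : Y = {x, y}) (hne : Y.Nonempty) (hsub : Y ⊆ K) (hle : x.child ≤ y.child) :
    word (split x y (node Y hne hsub sub)) =
      wordAt sub x.parent * (wordAt sub y.parent * wordAt sub y.child) := by
  have hx : x ∈ K := hsub (hY ▸ Or.inl rfl)
  obtain ⟨C₀, h₀, hy⟩ := exists_isComponent (G := graph T) (X := K \ {x}) (a := y)
    ⟨hsub (hY ▸ Or.inr rfl), hxy.symm⟩
  rw [word_split_root hY hne hsub h₀ hy, if_neg fun h => (h₀.parent_mem_iff hK hx hy).1 h hle,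
    if_pos ((h₀.child_mem_iff hK hx hy).2 hle)]

/-- This covers both `y` below `x` and `y` incomparable to `x`: in either case `y` is on the lower
side of `x`, so its product becomes the left factor. -/
theorem word_split_root_of_not_le (hK : IsConnected (ofGraph (graph T)) K) (hxy : x ≠ y)
    (hY : Y = {x, y}) (hne : Y.Nonempty) (hsub : Y ⊆ K) (hle : ¬ x.child ≤ y.child) :
    word (split x y (node Y hne hsub sub)) =
      (wordAt sub y.parent * wordAt sub y.child) * wordAt sub x.child := by
  have hx : x ∈ K := hsub (hY ▸ Or.inl rfl)
  obtain ⟨C₀, h₀, hy⟩ := exists_isComponent (G := graph T) (X := K \ {x}) (a := y)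
    ⟨hsub (hY ▸ Or.inr rfl), hxy.symm⟩
  rw [word_split_root hY hne hsub h₀ hy, if_pos ((h₀.parent_mem_iff hK hx hy).2 hle),
    if_neg fun h => hle ((h₀.child_mem_iff hK hx hy).1 h)]

/-- The end of `x` that is on the side of `y` and the lower end of `y` lie in the same part of the
tree when `x` and `y` are removed, provided that the former is not above `y`. -/
theorem wordAt_eq_of_mem (hY : Y = {x, y}) {C₀ : Set (TreeEdge T)}
    (h₀ : IsComponent (ofGraph (graph T)) (K \ {x}) C₀) (hy : y ∈ C₀) {a : T}
    (ha : a ∈ nodesOf C₀) (hle : ¬ y.child ≤ a) : wordAt sub a = wordAt sub y.parent := by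
  subst hY
  obtain ⟨e, he, hae⟩ := ha
  by_cases hey : e = y
  · subst hey
    rcases hae with rfl | rfl
    · rfl
    · exact absurd le_rfl hle
  · obtain ⟨D, hD, heD⟩ := exists_isComponent (G := graph T) (X := C₀ \ {y}) (a := e) ⟨he, hey⟩
    have haD : a ∈ nodesOf D := ⟨e, heD, hae⟩
    have hyD : y.parent ∈ nodesOf D := (hD.parent_or_child_mem h₀.2.1 hy).resolve_right fun h =>
      hle ((hD.2.1.child_le_iff (fun h => (hD.1 h).2 rfl) h haD).1 le_rfl)
    have hD' := isComponent_pair_of_mem h₀ hD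
    rw [wordAt_of_mem hD' haD, wordAt_of_mem hD' hyD]

/-- This is the middle part of the chain, reached from the top of `x` or from the bottom of `y`. -/
theorem wordAt_child_eq (hK : IsConnected (ofGraph (graph T)) K) (hxy : x ≠ y)
    (hY : Y = {x, y}) (hsub : Y ⊆ K) (hle : x.child ≤ y.child) :
    wordAt sub x.child = wordAt sub y.parent := by
  obtain ⟨C₀, h₀, hy⟩ := exists_isComponent (G := graph T) (X := K \ {x}) (a := y)
    ⟨hsub (hY ▸ Or.inr rfl), hxy.symm⟩
  exact wordAt_eq_of_mem hY h₀ hy ((h₀.child_mem_iff hK (hsub (hY ▸ Or.inl rfl)) hy).2 hle)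
    fun h => hxy (TreeEdge.eq_of_child_eq (hle.antisymm h))

/-- This is the common lower part on which two incomparable edges stand. -/
theorem wordAt_parent_eq (hK : IsConnected (ofGraph (graph T)) K) (hxy : x ≠ y)
    (hY : Y = {x, y}) (hsub : Y ⊆ K) (hle : ¬ x.child ≤ y.child) (hle' : ¬ y.child ≤ x.child) :
    wordAt sub x.parent = wordAt sub y.parent := by
  obtain ⟨C₀, h₀, hy⟩ := exists_isComponent (G := graph T) (X := K \ {x}) (a := y)
    ⟨hsub (hY ▸ Or.inr rfl), hxy.symm⟩
  exact wordAt_eq_of_mem hY h₀ hy ((h₀.parent_mem_iff hK (hsub (hY ▸ Or.inl rfl)) hy).2 hle)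
    fun h => hle' (h.trans x.parent_lt_child.le)

end WordSplit

/-! ### From the split node down to the root -/

section Context

open Construct

/-- A relation between the words of the two splittings of a two-element node propagates to the
root. -/
theorem word_split_rel {x y : TreeEdge T} (R : FreeMagma T → FreeMagma T → Prop)
    (hl : ∀ z w w', R w w' → R (w * z) (w' * z)) (hr : ∀ z w w', R w w' → R (z * w) (z * w'))
    (base : ∀ (K Y : Set (TreeEdge T)) (hne : Y.Nonempty) (hsub : Y ⊆ K)
      (sub : ∀ C, IsComponent (ofGraph (graph T)) (K \ Y) C → Construct (ofGraph (graph T)) C),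
      IsConnected (ofGraph (graph T)) K → Y = {x, y} →
        R (word (split x y (node Y hne hsub sub))) (word (split y x (node Y hne hsub sub))))
    {K : Set (TreeEdge T)} (hK : IsConnected (ofGraph (graph T)) K)
    {E : Construct (ofGraph (graph T)) K} (hE : E.IsEdge x y) :
    R (word (split x y E)) (word (split y x E)) := by
  induction E with
  | @node K Y hne hsub sub ih =>
    by_cases hY : Y = {x, y}
    · exact base K Y hne hsub sub hK hY
    obtain ⟨C, hC, hm⟩ := hE.2.1.resolve_left (Ne.symm hY)
    obtain ⟨z, rfl⟩ := hE.2.2 Y (Or.inl rfl) hY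
    have hz : z ∈ K := hsub rfl
    rw [split_of_ne hY, split_of_ne (Set.pair_comm x y ▸ hY), word_node_singleton,
      word_node_singleton]
    have hsame : ∀ a ∉ nodesOf C, wordAt (X := K \ {z}) (fun D hD => split x y (sub D hD)) a =
        wordAt (X := K \ {z}) (fun D hD => split y x (sub D hD)) a := fun a ha =>
      wordAt_congr (fun D hD haD => ⟨hD, by
        have hn : {x, y} ∉ (sub D hD).labels := fun h =>
          ha (eq_of_mem_labels hC hD hm h ▸ haD)
        rw [split_eq_self hn, split_eq_self (Set.pair_comm x y ▸ hn)]⟩) fun _ h _ => h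
    have hrel : ∀ a ∈ nodesOf C, R (wordAt (X := K \ {z}) (fun D hD => split x y (sub D hD)) a)
        (wordAt (X := K \ {z}) (fun D hD => split y x (sub D hD)) a) := fun a ha => by
      rw [wordAt_of_mem hC ha, wordAt_of_mem hC ha]
      exact ih C hC hC.2.1 (hE.sub_isEdge C hC hm)
    obtain ⟨c, hc⟩ := hC.2.1.2.1
    -- The component holding the pair touches exactly one end of `z`, so exactly one factor of the
    -- word changes.
    by_cases hle : z.child ≤ c.child
    · rw [hsame _ fun h => (hC.parent_mem_iff hK hz hc).1 h hle]
      exact hr _ _ _ (hrel _ ((hC.child_mem_iff hK hz hc).2 hle))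
    · rw [hsame _ fun h => hle ((hC.child_mem_iff hK hz hc).1 h)]
      exact hl _ _ _ (hrel _ ((hC.parent_mem_iff hK hz hc).2 hle))

variable {K : Set (TreeEdge T)} {E : Construct (ofGraph (graph T)) K} {x y : TreeEdge T}

theorem beta_word_split (hK : IsConnected (ofGraph (graph T)) K) (hE : E.IsEdge x y)
    (hle : x.child ≤ y.child) : Beta (word (split y x E)) (word (split x y E)) := by
  -- The relation is reversed because the splitting with the lower tree edge `x` at the bottom is
  -- the target of the β-step.
  refine word_split_rel (fun w w' => Beta w' w) (fun z _ _ => Beta.left z)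
    (fun z _ _ => Beta.right z) (fun K Y hne hsub sub hK hY => ?_) hK hE
  have hle' : ¬ y.child ≤ x.child := fun h => hE.1 (TreeEdge.eq_of_child_eq (hle.antisymm h))
  rw [word_split_root_of_le hK hE.1 hY hne hsub hle, word_split_root_of_not_le hK hE.1.symm
    (hY.trans (Set.pair_comm x y)) hne hsub hle', wordAt_child_eq hK hE.1 hY hsub hle]
  exact Beta.assoc _ _ _

theorem theta_word_split (hK : IsConnected (ofGraph (graph T)) K) (hE : E.IsEdge x y)
    (hle : ¬ x.child ≤ y.child) (hle' : ¬ y.child ≤ x.child) :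
    Theta (word (split x y E)) (word (split y x E)) := by
  refine word_split_rel Theta (fun z _ _ => Theta.left z)
    (fun z _ _ => Theta.right z) (fun K Y hne hsub sub hK hY => ?_) hK hE
  rw [word_split_root_of_not_le hK hE.1 hY hne hsub hle, word_split_root_of_not_le hK hE.1.symm
    (hY.trans (Set.pair_comm x y)) hne hsub hle', wordAt_parent_eq hK hE.1 hY hsub hle hle']
  exact Theta.swap _ _ _

end Context

/-! ### Invariants of words -/

section Invariants

variable {A : Type u}

/-- The letters of a word, from left to right. -/
def letters : FreeMagma A → List A
  | .of a => [a]
  | .mul w w' => letters w ++ letters w'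

theorem letters_of (a : A) : letters (FreeMagma.of a) = [a] := rfl

theorem letters_mul (w w' : FreeMagma A) : letters (w * w') = letters w ++ letters w' := rfl

theorem letters_ne_nil (w : FreeMagma A) : letters w ≠ [] := by
  induction w with
  | ih1 a => simp [letters_of]
  | ih2 w w' ih _ => simp [letters_mul, ih]

/-- The total number of the letters that precede a multiplication, inside its left factor. -/
def leftWeight : FreeMagma A → ℕ
  | .of _ => 0
  | .mul w w' => leftWeight w + leftWeight w' + (letters w).length

theorem leftWeight_mul (w w' : FreeMagma A) :
    leftWeight (w * w') = leftWeight w + leftWeight w' + (letters w).length := rfl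

theorem Beta.letters_eq {w w' : FreeMagma A} (h : Beta w w') : letters w' = letters w := by
  induction h with
  | assoc => simp [letters_mul]
  | left _ _ ih => simp [letters_mul, ih]
  | right _ _ ih => simp [letters_mul, ih]

/-- Reassociating lowers the weight by the length of `w₁`, which is positive. -/
theorem Beta.leftWeight_lt {w w' : FreeMagma A} (h : Beta w w') : leftWeight w' < leftWeight w := by
  induction h with
  | assoc w₁ w₂ w₃ =>
    have := List.length_pos_iff.2 (letters_ne_nil w₁)
    simp only [leftWeight_mul, letters_mul, List.length_append]
    omega
  | left _ h ih => simp only [leftWeight_mul, h.letters_eq]; omega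
  | right _ h ih => simp only [leftWeight_mul]; omega

theorem Theta.letters_ne {w w' : FreeMagma A} (h : Theta w w') (hw : (letters w).Nodup) :
    letters w' ≠ letters w := by
  induction h with
  | swap w₁ w₂ w₃ =>
    simp only [letters_mul, List.append_assoc, ne_eq, List.append_cancel_left_eq]
    simp only [letters_mul, List.append_assoc] at hw
    have hd := List.disjoint_of_nodup_append (List.nodup_append.1 hw).2.1
    -- After the common prefix `w₁`, the two sequences start with the first letters of `w₂` and
    -- `w₃`, which differ since no letter is repeated.
    obtain ⟨a, l, ha⟩ := List.exists_cons_of_ne_nil (letters_ne_nil w₂)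
    obtain ⟨b, l', hb⟩ := List.exists_cons_of_ne_nil (letters_ne_nil w₃)
    rw [ha, hb] at hd ⊢
    intro h
    obtain rfl : b = a := by simpa using (List.cons.inj h).1
    exact hd (List.mem_cons_self) (List.mem_cons_self)
  | left z _ ih =>
    simp only [letters_mul, ne_eq, List.append_cancel_right_eq] at hw ⊢
    exact ih (List.nodup_append.1 hw).1
  | right z _ ih =>
    simp only [letters_mul, ne_eq, List.append_cancel_left_eq] at hw ⊢
    exact ih (List.nodup_append.1 hw).2.1

end Invariants

/-- The letters of the two factors lie on opposite sides of the removed edge, so they cannot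
coincide. -/
theorem nodup_letters_word {K : Set (TreeEdge T)} (S : Construct (ofGraph (graph T)) K) :
    (letters (word S)).Nodup ∧ ∀ a ∈ letters (word S), a ∈ nodesOf K := by
  induction S with
  | @node K Y hne hsub sub ih =>
    have hx := hne.some_mem
    rw [word_node, letters_mul]
    set x := hne.some
    have key : ∀ a ∈ x.ends, (letters (wordAt sub a)).Nodup ∧
        ∀ b ∈ letters (wordAt sub a), b ∈ nodesOf K ∧ (x.child ≤ a ↔ x.child ≤ b) := by
      intro a ha
      by_cases h : ∃ C, IsComponent (ofGraph (graph T)) (K \ Y) C ∧ a ∈ nodesOf C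
      · obtain ⟨C, hC, haC⟩ := h
        rw [wordAt_of_mem hC haC]
        refine ⟨(ih C hC).1, fun b hb => ?_⟩
        have hbC := (ih C hC).2 b hb
        obtain ⟨e, he, hbe⟩ := id hbC
        exact ⟨⟨e, (hC.1 he).1, hbe⟩, hC.2.1.child_le_iff (fun h => (hC.1 h).2 hx) haC hbC⟩
      · rw [wordAt_of_forall_notMem fun C hC haC => h ⟨C, hC, haC⟩, letters_of]
        refine ⟨List.nodup_singleton a, fun b hb => ?_⟩
        obtain rfl := List.mem_singleton.1 hb
        exact ⟨⟨x, hsub hx, ha⟩, Iff.rfl⟩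
    have hp := key _ x.parent_mem_ends
    have hc := key _ x.child_mem_ends
    refine ⟨List.nodup_append.2 ⟨hp.1, hc.1, fun a ha b hb hab => ?_⟩, fun a ha => ?_⟩
    · subst hab
      exact x.parent_lt_child.not_ge ((hp.2 a ha).2.2 ((hc.2 a hb).2.1 le_rfl))
    · exact (List.mem_append.1 ha).elim (fun h => (hp.2 a h).1) fun h => (hc.2 a h).1

end Words

/-! ### Min-paths -/

section MinPath

/-- A walk that realises the distance is automatically a path, so restricting the competition to
paths changes nothing. -/
theorem isMinPath_iff_length_eq_dist {α : Type u} {G : SimpleGraph α} {x y : α} (p : G.Walk x y) :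
    IsMinPath p ↔ p.length = G.dist x y := by
  refine ⟨fun h => ?_, fun h => ⟨p.isPath_of_length_eq_dist h, fun q _ =>
    h ▸ SimpleGraph.dist_le q⟩⟩
  obtain ⟨q, hq⟩ := p.reachable.exists_walk_length_eq_dist
  exact le_antisymm (hq ▸ h.2 q (q.isPath_of_length_eq_dist hq)) (SimpleGraph.dist_le p)

theorem walk_eq_of_length_eq_one {α : Type u} {G : SimpleGraph α} {x y : α} (h : G.Adj x y)
    (p : G.Walk x y) (hp : p.length = 1) : p = .cons h .nil := by
  match p with
  | .cons _ .nil => rfl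
  | .cons _ (.cons _ _) => simp at hp

variable {T : RootedTree.{u}} {x y : TreeEdge T}

/-- A walk that enters the part of the tree above the edge `z` passes through `z`. -/
theorem mem_support_of_child_le {z : TreeEdge T} (p : (graph T).Walk x y)
    (hx : ¬ z.child ≤ x.child) (hy : z.child ≤ y.child) : z ∈ p.support := by
  induction p with
  | nil => exact absurd hy hx
  | @cons x w y h p ih =>
    rw [SimpleGraph.Walk.support_cons]
    refine List.mem_cons_of_mem _ ?_
    by_cases hw : w = z
    · exact hw ▸ p.start_mem_support
    · refine ih (fun hzw => hx ?_) hy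
      exact (TreeEdge.child_le_child_iff_of_adj (by rintro rfl; exact hx le_rfl) hw h).2 hzw

/-- There is a unique shortest walk from `x` to `y`, and it is solid if and only if `x` and `y`
are comparable. -/
def HasUniqueGeodesic (x y : TreeEdge T) : Prop :=
  ∃ p : (graph T).Walk x y, (∀ q : (graph T).Walk x y, q.length = (graph T).dist x y ↔ q = p) ∧
    (AllSolid p ↔ x.child ≤ y.child ∨ y.child ≤ x.child)

theorem HasUniqueGeodesic.symm (h : HasUniqueGeodesic x y) : HasUniqueGeodesic y x := by
  obtain ⟨p, hp, hs⟩ := h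
  refine ⟨p.reverse, fun q => ?_, ?_⟩
  · rw [SimpleGraph.dist_comm, ← SimpleGraph.Walk.length_reverse, hp]
    exact ⟨fun h => by rw [← h, SimpleGraph.Walk.reverse_reverse],
      fun h => by rw [h, SimpleGraph.Walk.reverse_reverse]⟩
  · rw [or_comm, ← hs]
    have h : ∀ {x y : TreeEdge T} (p : (graph T).Walk x y), AllSolid p → AllSolid p.reverse := by
      intro x y p hp d hd
      rw [SimpleGraph.Walk.darts_reverse, List.mem_reverse, List.mem_map] at hd
      obtain ⟨d, hd, rfl⟩ := hd
      exact (hp d hd).symm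
    exact ⟨fun hp => p.reverse_reverse ▸ h _ hp, h p⟩

theorem hasUniqueGeodesic_self (x : TreeEdge T) : HasUniqueGeodesic x x := by
  refine ⟨.nil, fun q => ?_, ?_⟩
  · rw [SimpleGraph.dist_self, SimpleGraph.Walk.length_eq_zero_iff, SimpleGraph.Walk.eq_nil_iff_nil]
  · simp [AllSolid]

/-- Siblings. -/
theorem hasUniqueGeodesic_of_parent_eq (hxy : x ≠ y) (h : x.parent = y.parent) :
    HasUniqueGeodesic x y := by
  have hadj : (graph T).Adj x y :=
    graph_adj_of_mem_ends hxy x.parent_mem_ends (h ▸ y.parent_mem_ends)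
  refine ⟨.cons hadj .nil, fun q => ?_, ?_⟩
  · rw [SimpleGraph.dist_eq_one_iff_adj.2 hadj]
    exact ⟨walk_eq_of_length_eq_one hadj q, fun h => h ▸ rfl⟩
  · have h₁ : ¬ Solid x y := by
      rintro (h' | h')
      · exact x.parent_lt_child.ne' (h'.trans h.symm)
      · exact y.parent_lt_child.ne' (h'.trans h)
    have h₂ : ¬ (x.child ≤ y.child ∨ y.child ≤ x.child) := by
      rintro (h' | h')
      · exact x.parent_lt_child.not_ge (h ▸ TreeEdge.le_parent_of_lt_child
          (h'.lt_of_ne fun h => hxy (TreeEdge.eq_of_child_eq h)))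
      · exact y.parent_lt_child.not_ge (h ▸ TreeEdge.le_parent_of_lt_child
          (h'.lt_of_ne fun h => hxy (TreeEdge.eq_of_child_eq h.symm)))
    simp [AllSolid, h₁, h₂]

/-- Extension of a geodesic from the edge `z` to an edge `y` on top of it. -/
theorem HasUniqueGeodesic.extend {z : TreeEdge T} (hz : z.child = y.parent)
    (hx : ¬ z.child < x.child) (h : HasUniqueGeodesic x z) : HasUniqueGeodesic x y := by
  obtain ⟨p, hp, hs⟩ := h
  have hzy : z.child < y.child := hz ▸ y.parent_lt_child
  have hne : z ≠ y := fun h => hzy.ne (h ▸ rfl)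
  have hadj : (graph T).Adj z y :=
    graph_adj_of_mem_ends hne z.child_mem_ends (hz ▸ y.parent_mem_ends)
  have hmem : ∀ q : (graph T).Walk x y, z ∈ q.support := fun q => by
    by_cases hxz : x = z
    · exact hxz ▸ q.start_mem_support
    · exact mem_support_of_child_le q (fun h => hx (h.lt_of_ne fun h' =>
        hxz (TreeEdge.eq_of_child_eq h'.symm))) hzy.le
  have hplen := (hp p).2 rfl
  classical
  have hsplit : ∀ q : (graph T).Walk x y,
      q.length = (q.takeUntil z (hmem q)).length + (q.dropUntil z (hmem q)).length := fun q => by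
    rw [← SimpleGraph.Walk.length_append, SimpleGraph.Walk.take_spec]
  have hdrop : ∀ q : (graph T).Walk x y, 1 ≤ (q.dropUntil z (hmem q)).length := fun q =>
    Nat.one_le_iff_ne_zero.2 fun h => hne (SimpleGraph.Walk.eq_of_length_eq_zero h)
  have hdist : (graph T).dist x y = (graph T).dist x z + 1 := by
    refine le_antisymm ?_ ?_
    · rw [← hplen, ← SimpleGraph.Walk.length_concat p hadj]
      exact SimpleGraph.dist_le _
    · obtain ⟨q, hq⟩ := (p.concat hadj).reachable.exists_walk_length_eq_dist
      rw [← hq, hsplit q]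
      exact add_le_add (SimpleGraph.dist_le _) (hdrop q)
  refine ⟨p.concat hadj, fun q => ⟨fun hq => ?_, fun hq => ?_⟩, ?_⟩
  · have h₁ := hsplit q
    have h₂ := hdrop q
    have h₃ := SimpleGraph.dist_le (q.takeUntil z (hmem q))
    -- The length count leaves no slack: the walk reaches `z` along a geodesic and then takes a
    -- single step.
    have ht : q.takeUntil z (hmem q) = p := (hp _).1 (by omega)
    have hd := walk_eq_of_length_eq_one hadj (q.dropUntil z (hmem q)) (by omega)
    rw [← q.take_spec (hmem q), ht, hd, SimpleGraph.Walk.concat_eq_append]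
  · rw [hq, SimpleGraph.Walk.length_concat, hplen, hdist]
  · have h₁ : AllSolid (p.concat hadj) ↔ AllSolid p := by
      simp only [AllSolid, SimpleGraph.Walk.darts_concat, List.concat_eq_append, List.mem_append,
        List.mem_singleton]
      refine ⟨fun h d hd => h d (Or.inl hd), ?_⟩
      rintro h d (hd | rfl)
      · exact h d hd
      · exact Or.inl hz
    rw [h₁, hs]
    constructor
    · rintro (h | h)
      · exact Or.inl (h.trans hzy.le)
      · exact Or.inl ((h.eq_of_not_lt hx).symm.le.trans hzy.le)
    · rintro (h | h)
      · refine Or.inl (hz ▸ TreeEdge.le_parent_of_lt_child (h.lt_of_ne fun h' => hx ?_))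
        exact h' ▸ hzy
      · exact absurd (hzy.trans_le h) hx

/-- Induction on the pair of upper ends in the product order. An edge whose lower end is not
strictly below the other's upper end is replaced by the edge beneath it; when neither can be
replaced, the lower ends agree and the edges are siblings. -/
theorem hasUniqueGeodesic [Finite T] (x y : TreeEdge T) : HasUniqueGeodesic x y := by
  suffices h : ∀ c : T × T, ∀ x y : TreeEdge T, (x.child, y.child) = c → HasUniqueGeodesic x y from
    h _ x y rfl
  intro c
  induction c using WellFoundedLT.induction with
  | ind c ih =>
  rintro x y rfl
  by_cases hxy : x = y
  · exact hxy ▸ hasUniqueGeodesic_self x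
  -- The lower end is not the root, so there is an edge beneath to descend to.
  have key : ∀ {a : T} {e : TreeEdge T}, ¬ e.parent < a → a ≠ ⊥ → e.parent ≠ ⊥ := by
    intro a e h ha h'
    exact h (h' ▸ bot_lt_iff_ne_bot.2 ha)
  by_cases hy : y.parent < x.child
  · by_cases hx : x.parent < y.child
    · exact hasUniqueGeodesic_of_parent_eq hxy (le_antisymm
        (TreeEdge.le_parent_of_lt_child hx) (TreeEdge.le_parent_of_lt_child hy))
    · exact (HasUniqueGeodesic.extend (z := ⟨x.parent, key hx y.child_ne_root⟩) rfl hx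
        (ih _ (Prod.mk_lt_mk_iff_left.2 x.parent_lt_child) _ _ rfl).symm).symm
  · exact HasUniqueGeodesic.extend (z := ⟨y.parent, key hy x.child_ne_root⟩) rfl hy
      (ih _ (Prod.mk_lt_mk_iff_right.2 y.parent_lt_child) _ _ rfl)

theorem isConnected_vertexSet [Finite T] (x : TreeEdge T) :
    IsConnected (ofGraph (graph T)) (ofGraph (graph T)).vertexSet := by
  refine isConnected_of_reachable (a := x) trivial fun y _ => ?_
  obtain ⟨p, -⟩ := hasUniqueGeodesic x y
  induction p with
  | nil => exact .refl
  | cons h _ ih => exact .head ⟨h, trivial⟩ (ih trivial)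

theorem level_lt_level [Finite T] (h : x.child < y.child) : x.level < y.level := by
  refine Order.height_strictMono h ?_
  -- Strictness in `ℕ∞` requires a finite height; the number of nodes bounds the length of chains.
  have := Fintype.ofFinite T
  refine lt_of_le_of_lt (b := (Fintype.card T : ℕ∞)) ?_ (ENat.natCast_lt_top _)
  exact Order.height_le fun p _ => by exact_mod_cast p.length_lt_card.le

end MinPath

/-! ### Arrows -/

section Arrows

open Construct

variable {T : RootedTree.{u}} {E V V' : Face T} {x y : TreeEdge T}

theorem eq_split_of_hasEnds (hE : E.IsEdge x y) (h : HasEnds E V V') :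
    (V = split x y E ∧ V' = split y x E) ∨ (V = split y x E ∧ V' = split x y E) := by
  have hV := (hE.isConstruction_and_le_iff V).1 ((h.2 V).2 (Or.inl rfl))
  have hV' := (hE.isConstruction_and_le_iff V').1 ((h.2 V').2 (Or.inr rfl))
  have hne := h.1
  rcases hV with rfl | rfl <;> rcases hV' with rfl | rfl
  · exact absurd rfl hne
  · exact Or.inl ⟨rfl, rfl⟩
  · exact Or.inr ⟨rfl, rfl⟩
  · exact absurd rfl hne

theorem hasEnds_split (hE : E.IsEdge x y) (hne : split x y E ≠ split y x E) :
    HasEnds E (split x y E) (split y x E) :=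
  ⟨hne, hE.isConstruction_and_le_iff⟩

theorem Beta.not_symm {A : Type u} {w w' : FreeMagma A} (h : Beta w w') : ¬ Beta w' w :=
  fun h' => (h.leftWeight_lt.trans h'.leftWeight_lt).false

theorem IsThetaArrow.letters_ne (h : IsThetaArrow E V V') :
    letters (word V') ≠ letters (word V) :=
  h.2.letters_ne (nodup_letters_word V).1

variable [Finite T]

/-- The direction is forced, since the opposite β-step would raise `leftWeight`. The same asymmetry
shows that the two splittings are distinct. -/
theorem isBetaArrow_iff_of_le (hE : E.IsEdge x y) (hle : x.child ≤ y.child) :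
    IsBetaArrow E V V' ↔ V = split y x E ∧ V' = split x y E := by
  have hβ := beta_word_split (isConnected_vertexSet x) hE hle
  constructor
  · rintro ⟨h, h'⟩
    rcases eq_split_of_hasEnds hE h with ⟨rfl, rfl⟩ | h
    · exact absurd h' hβ.not_symm
    · exact h
  · rintro ⟨rfl, rfl⟩
    exact ⟨hasEnds_split hE.symm fun h => hβ.not_symm (h ▸ hβ), hβ⟩

theorem letters_word_eq_of_le (hE : E.IsEdge x y) (hle : x.child ≤ y.child) (h : HasEnds E V V') :
    letters (word V') = letters (word V) := by
  have hβ := (beta_word_split (isConnected_vertexSet x) hE hle).letters_eq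
  rcases eq_split_of_hasEnds hE h with ⟨rfl, rfl⟩ | ⟨rfl, rfl⟩
  · exact hβ.symm
  · exact hβ

theorem isThetaArrow_of_not_le (hE : E.IsEdge x y) (hle : ¬ x.child ≤ y.child)
    (hle' : ¬ y.child ≤ x.child) : IsThetaArrow E (split x y E) (split y x E) := by
  have hθ := theta_word_split (isConnected_vertexSet x) hE hle hle'
  exact ⟨hasEnds_split hE fun h => hθ.letters_ne (nodup_letters_word _).1 (h ▸ rfl), hθ⟩

theorem not_isBetaArrow_of_not_le (hE : E.IsEdge x y) (hle : ¬ x.child ≤ y.child)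
    (hle' : ¬ y.child ≤ x.child) : ¬ IsBetaArrow E V V' := by
  rintro ⟨h, hβ⟩
  rcases eq_split_of_hasEnds hE h with ⟨rfl, rfl⟩ | ⟨rfl, rfl⟩
  · exact (isThetaArrow_of_not_le hE hle hle').letters_ne hβ.letters_eq
  · exact (isThetaArrow_of_not_le hE.symm hle' hle).letters_ne hβ.letters_eq

theorem exists_isBetaArrow_iff (hE : E.IsEdge x y) :
    (∃ V V', IsBetaArrow E V V') ↔ x.child ≤ y.child ∨ y.child ≤ x.child := by
  constructor
  · rintro ⟨V, V', h⟩
    by_contra! hn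
    exact not_isBetaArrow_of_not_le hE hn.1 hn.2 h
  · rintro (h | h)
    · exact ⟨_, _, (isBetaArrow_iff_of_le hE h).2 ⟨rfl, rfl⟩⟩
    · exact ⟨_, _, (isBetaArrow_iff_of_le hE.symm h).2 ⟨rfl, rfl⟩⟩

theorem exists_isThetaArrow_iff (hE : E.IsEdge x y) :
    (∃ V V', IsThetaArrow E V V') ↔ ¬ (x.child ≤ y.child ∨ y.child ≤ x.child) := by
  constructor
  · rintro ⟨V, V', h⟩ (hle | hle)
    · exact h.letters_ne (letters_word_eq_of_le hE hle h.1)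
    · exact h.letters_ne (letters_word_eq_of_le hE.symm hle h.1)
  · intro h
    push Not at h
    exact ⟨_, _, isThetaArrow_of_not_le hE h.1 h.2⟩

/-- In the target of a β-arrow, the tree edge nearer to the root is the lower label; comparability
turns this into a comparison of levels. -/
theorem IsBetaArrow.below_iff (h : IsBetaArrow E V V') (hE : E.IsEdge x y) :
    V'.Below {x} {y} ↔ x.level < y.level := by
  rcases (exists_isBetaArrow_iff hE).1 ⟨V, V', h⟩ with hle | hle
  · obtain ⟨rfl, rfl⟩ := (isBetaArrow_iff_of_le hE hle).1 h
    exact iff_of_true (split_below hE.1 hE.2.1)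
      (level_lt_level (hle.lt_of_ne fun h => hE.1 (TreeEdge.eq_of_child_eq h)))
  · obtain ⟨rfl, rfl⟩ := (isBetaArrow_iff_of_le hE.symm hle).1 h
    exact iff_of_false (split_below hE.symm.1 hE.symm.2.1).asymm
      (level_lt_level (hle.lt_of_ne fun h => hE.1 (TreeEdge.eq_of_child_eq h.symm))).not_gt

end Arrows

end Operadic

theorem mainTheorem4 (T : RootedTree) [Finite T] (E : Operadic.Face T)
    (x y : Operadic.TreeEdge T) (hE : E.IsEdge x y) :
    ∃ p : (Operadic.graph T).Walk x y,
      (∀ q : (Operadic.graph T).Walk x y, Operadic.IsMinPath q ↔ q = p) ∧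
      ((∃ V V', Operadic.IsBetaArrow E V V') ↔ Operadic.AllSolid p) ∧
      ((∃ V V', Operadic.IsThetaArrow E V V') ↔ ¬ Operadic.AllSolid p) ∧
      (∀ V V', Operadic.IsBetaArrow E V V' →
        (V'.Below {x} {y} ↔ x.level < y.level)) := by
  obtain ⟨p, hp, hs⟩ := Operadic.hasUniqueGeodesic x y
  refine ⟨p, fun q => (Operadic.isMinPath_iff_length_eq_dist q).trans (hp q), ?_, ?_,
    fun V V' h => h.below_iff hE⟩
  · rw [hs, Operadic.exists_isBetaArrow_iff hE]
  · rw [hs, Operadic.exists_isThetaArrow_iff hE]
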